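/- Let $p$ be an odd prime, $m>1$ and $q=p^m$, and let $a=1/4\in\mathrm{GF}(q)$. Let $\mathcal C_{\mathcal V}$ be the linear code over $\mathrm{GF}(q)$ generated by the $4\times(q^2+1)$ matrix whose columns are $(x,\,y,\,x^2+xy+ay^2,\,1)^T$ for $(x,y)\in\mathrm{GF}(q)^2$, together with $(0,0,1,0)^T$. The subfield code $\mathcal C_{\mathcal V}^{(p)}$ is the code over $\mathrm{GF}(p)$ generated by the rows of the matrix obtained from a generator matrix of $\mathcal C_{\mathcal V}$ by replacing each entry by the column vector in $\mathrm{GF}(p)^m$ of its coordinates with respect to a basis of $\mathrm{GF}(q)$ over $\mathrm{GF}(p)$. For every choice of the generator matrix and of the basis, $\mathcal C_{\mathcal V}^{(p)}$ is a $[p^{2m}+1,\,3m+1]$ linear code over $\mathrm{GF}(p)$ with the following weight distribution: the listed weights are pairwise distinct, the number of codewords of each listed weight is as stated (possibly $0$), and no other weight occurs. If $m$ is even, put $\varepsilon=(\sqrt{-1})^{(p-1)m/2}$: | Weight | Multiplicity | |---|---| | $0$ | $1$ | | $p^{2m}$ | $p-1$ | | $p^{2m-1}(p-1)$ | $(p^m-1)(p^{2m}+p)$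 | | $p^{2m-1}(p-1)+1$ | $p^{2m}(p^m-1)(p-1)$ | | $p^{m-1}(p-1)(p^m+p^{m/2}\varepsilon)$ | $\frac12\left(p^{2m-1}-p^m-(p-1)p^{(3m-2)/2}\varepsilon\right)$ | | $p^{m-1}(p-1)(p^m+p^{m/2}\varepsilon)+1$ | $\frac12(p-1)\left(p^{2m-1}+p^{(3m-2)/2}\varepsilon\right)$ | | $p^{m-1}(p^m(p-1)-p^{m/2}\varepsilon)$ | $\frac12(p-1)\left(p^{2m-1}-p^m-(p-1)p^{(3m-2)/2}\varepsilon\right)$ | | $p^{m-1}(p^m(p-1)-p^{m/2}\varepsilon)+1$ | $\frac12(p-1)^2\left(p^{2m-1}+p^{(3m-2)/2}\varepsilon\right)$ | | $p^{m-1}(p-1)(p^m-p^{m/2}\varepsilon)$ | $\frac12\left(p^{2m-1}-p^m+(p-1)p^{(3m-2)/2}\varepsilon\right)$ | | $p^{m-1}(p-1)(p^m-p^{m/2}\varepsilon)+1$ | $\frac12(p-1)\left(p^{2m-1}-p^{(3m-2)/2}\varepsilon\right)$ | | $p^{m-1}(p^m(p-1)+p^{m/2}\varepsilon)$ | $\frac12(p-1)\left(p^{2m-1}-p^m+(p-1)p^{(3m-2)/2}\varepsilon\right)$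 | | $p^{m-1}(p^m(p-1)+p^{m/2}\varepsilon)+1$ | $\frac12(p-1)^2\left(p^{2m-1}-p^{(3m-2)/2}\varepsilon\right)$ | If $m$ is odd, put $\delta=(\sqrt{-1})^{(p-1)(m+1)/2}$: | Weight | Multiplicity | |---|---| | $0$ | $1$ | | $p^{2m}$ | $p-1$ | | $p^{2m-1}(p-1)$ | $p^m(p^{m-1}-1)(p^{m+1}-p+1)+p(p^{2m}-1)$ | | $p^{2m-1}(p-1)+1$ | $p^{2m-1}(p-1)(p^{m+1}-p+1)$ | | $p^{(3m-1)/2}\left(p^{(m-1)/2}(p-1)-\delta\right)$ | $\frac12p^m(p^{m-1}-1)(p-1)$ | | $p^{(3m-1)/2}\left(p^{(m-1)/2}(p-1)-\delta\right)+1$ | $\frac12p^{2m-1}(p-1)^2$ | | $p^{(3m-1)/2}\left(p^{(m-1)/2}(p-1)+\delta\right)$ | $\frac12p^m(p^{m-1}-1)(p-1)$ | | $p^{(3m-1)/2}\left(p^{(m-1)/2}(p-1)+\delta\right)+1$ | $\frac12p^{2m-1}(p-1)^2$ | -/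

import Mathlib

/-- The linear code over `F` spanned by the rows of a matrix `G` whose columns are indexed by `ι`
(so that the code has length `|ι|`). -/
def rowCode {F κ ι : Type*} [Field F] (G : Matrix κ ι F) : Submodule F (ι → F) :=
  Submodule.span F (Set.range fun i : κ => G i)

/-- `G` is a generator matrix of the linear code `C`: its rows form a basis of `C`. -/
def IsGeneratorMatrix {F κ ι : Type*} [Field F] (G : Matrix κ ι F)
    (C : Submodule F (ι → F)) : Prop :=
  LinearIndependent F (fun i : κ => G i) ∧ rowCode G = C

/-- The matrix over the subfield `K` obtained from `G` by replacing each entry by the column vector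
of its coordinates with respect to the `K`-basis `b` of `F`. -/
noncomputable def expandMatrix {K F κ ι β : Type*} [Field K] [Field F] [Algebra K F]
    (b : Module.Basis β K F) (G : Matrix κ ι F) : Matrix (κ × β) ι K :=
  Matrix.of fun r s => b.repr (G r.1 s) r.2

/-- The subfield code over `K` built from a generator matrix `G` and a basis `b` of `F` over `K`:
the code generated by the expanded matrix. -/
noncomputable def subfieldCode {K F κ ι β : Type*} [Field K] [Field F] [Algebra K F]
    (b : Module.Basis β K F) (G : Matrix κ ι F) : Submodule K (ι → K) :=
  rowCode (expandMatrix b G)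

/-- The points `(x, y, x² + xy + ay², 1)`, for `x, y ∈ F`, and `(0, 0, 1, 0)`. -/
def quadricPoint {F : Type*} [Field F] (a : F) : Option (F × F) → Fin 4 → F
  | some (x, y) => ![x, y, x ^ 2 + x * y + a * y ^ 2, 1]
  | none => ![0, 0, 1, 0]

/-- The `4 × (q² + 1)` matrix whose columns are these points. -/
def quadricMatrix {F : Type*} [Field F] (a : F) : Matrix (Fin 4) (Option (F × F)) F :=
  Matrix.of fun i s => quadricPoint a s i

/-- The code over `F` with this generator matrix. -/
def quadricCode {F : Type*} [Field F] (a : F) : Submodule F (Option (F × F) → F) :=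
  rowCode (quadricMatrix a)

theorem isGeneratorMatrix_quadricMatrix {F : Type*} [Field F] (a : F) :
    IsGeneratorMatrix (quadricMatrix a) (quadricCode a) := by
  refine ⟨?_, rfl⟩
  rw [Fintype.linearIndependent_iff]
  intro c hc
  have h0 := congrFun hc none
  have h1 := congrFun hc (some (0, 0))
  have h2 := congrFun hc (some (1, 0))
  have h3 := congrFun hc (some (0, 1))
  simp [Fin.sum_univ_four, quadricMatrix, quadricPoint] at h0 h1 h2 h3
  simp [h0, h1] at h2 h3
  intro i
  fin_cases i <;> simp [h0, h1, h2, h3]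

/-- `A_w`: the number of codewords of Hamming weight `w`. -/
noncomputable def weightCount {K ι : Type*} [Field K] [DecidableEq K] [Fintype ι]
    (C : Submodule K (ι → K)) (w : ℕ) : ℕ :=
  Set.ncard {c : ι → K | c ∈ C ∧ hammingNorm c = w}

/-- The table `T` of pairs (weight, multiplicity) is the weight distribution of `C`: the listed
weights are pairwise distinct natural numbers, each with the listed multiplicity, and every weight
that occurs in `C` is listed. (A listed multiplicity may be `0`. The entries are complex numbers
because they are written in terms of `√-1`.) -/
def HasWeightDistribution {K ι : Type*} [Field K] [DecidableEq K] [Fintype ι]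
    (C : Submodule K (ι → K)) (T : List (ℂ × ℂ)) : Prop :=
  (T.map Prod.fst).Nodup ∧
  (∀ r ∈ T, ∃ w : ℕ, (w : ℂ) = r.1 ∧ (weightCount C w : ℂ) = r.2) ∧
  (∀ w : ℕ, weightCount C w ≠ 0 → ∃ r ∈ T, (w : ℂ) = r.1)

/-- The weight distribution for even `m`; here `p` is odd, so that all divisions in the exponents
are exact. -/
noncomputable def tableEven (p m : ℕ) : List (ℂ × ℂ) :=
  let P : ℂ := p
  let ε : ℂ := Complex.I ^ ((p - 1) / 2 * m)
  [ (0, 1),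
    (P ^ (2 * m), P - 1),
    (P ^ (2 * m - 1) * (P - 1), (P ^ m - 1) * (P ^ (2 * m) + P)),
    (P ^ (2 * m - 1) * (P - 1) + 1, P ^ (2 * m) * (P ^ m - 1) * (P - 1)),
    (P ^ (m - 1) * (P - 1) * (P ^ m + P ^ (m / 2) * ε),
      (P ^ (2 * m - 1) - P ^ m - (P - 1) * P ^ ((3 * m - 2) / 2) * ε) / 2),
    (P ^ (m - 1) * (P - 1) * (P ^ m + P ^ (m / 2) * ε) + 1,
      (P - 1) * (P ^ (2 * m - 1) + P ^ ((3 * m - 2) / 2) * ε) / 2),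
    (P ^ (m - 1) * (P ^ m * (P - 1) - P ^ (m / 2) * ε),
      (P - 1) * (P ^ (2 * m - 1) - P ^ m - (P - 1) * P ^ ((3 * m - 2) / 2) * ε) / 2),
    (P ^ (m - 1) * (P ^ m * (P - 1) - P ^ (m / 2) * ε) + 1,
      (P - 1) ^ 2 * (P ^ (2 * m - 1) + P ^ ((3 * m - 2) / 2) * ε) / 2),
    (P ^ (m - 1) * (P - 1) * (P ^ m - P ^ (m / 2) * ε),
      (P ^ (2 * m - 1) - P ^ m + (P - 1) * P ^ ((3 * m - 2) / 2) * ε) / 2),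
    (P ^ (m - 1) * (P - 1) * (P ^ m - P ^ (m / 2) * ε) + 1,
      (P - 1) * (P ^ (2 * m - 1) - P ^ ((3 * m - 2) / 2) * ε) / 2),
    (P ^ (m - 1) * (P ^ m * (P - 1) + P ^ (m / 2) * ε),
      (P - 1) * (P ^ (2 * m - 1) - P ^ m + (P - 1) * P ^ ((3 * m - 2) / 2) * ε) / 2),
    (P ^ (m - 1) * (P ^ m * (P - 1) + P ^ (m / 2) * ε) + 1,
      (P - 1) ^ 2 * (P ^ (2 * m - 1) - P ^ ((3 * m - 2) / 2) * ε) / 2) ]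

/-- The weight distribution for odd `m`; here `p` is odd, so that all divisions in the exponents
are exact. -/
noncomputable def tableOdd (p m : ℕ) : List (ℂ × ℂ) :=
  let P : ℂ := p
  let δ : ℂ := Complex.I ^ ((p - 1) * (m + 1) / 2)
  [ (0, 1),
    (P ^ (2 * m), P - 1),
    (P ^ (2 * m - 1) * (P - 1),
      P ^ m * (P ^ (m - 1) - 1) * (P ^ (m + 1) - P + 1) + P * (P ^ (2 * m) - 1)),
    (P ^ (2 * m - 1) * (P - 1) + 1, P ^ (2 * m - 1) * (P - 1) * (P ^ (m + 1) - P + 1)),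
    (P ^ ((3 * m - 1) / 2) * (P ^ ((m - 1) / 2) * (P - 1) - δ),
      P ^ m * (P ^ (m - 1) - 1) * (P - 1) / 2),
    (P ^ ((3 * m - 1) / 2) * (P ^ ((m - 1) / 2) * (P - 1) - δ) + 1,
      P ^ (2 * m - 1) * (P - 1) ^ 2 / 2),
    (P ^ ((3 * m - 1) / 2) * (P ^ ((m - 1) / 2) * (P - 1) + δ),
      P ^ m * (P ^ (m - 1) - 1) * (P - 1) / 2),
    (P ^ ((3 * m - 1) / 2) * (P ^ ((m - 1) / 2) * (P - 1) + δ) + 1,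
      P ^ (2 * m - 1) * (P - 1) ^ 2 / 2) ]

/-! By nondegeneracy of the trace form the subfield code is the trace code (`mem_subfieldCode_iff`).
For `a = 1/4` the quadratic form is the square of `z = x + y/2`, so the codewords are `Tr (u z + v y
+ w z ^ 2) + h` on the affine points and `Tr w` at infinity. The parameters `(u, v, w, h)` are
unique, which gives the dimension `3m + 1`.

Write `q = p ^ m` and `r = q / p`. If `v ≠ 0`, the word is equidistributed in `y` for each `z`. If
`v = w = 0`, it is affine. If `v = 0 ≠ w`, completing the square reduces the weight to `N_w(c)`, the
number of `z` with `Tr (w z ^ 2) = c` (`traceSqCount`).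

Gauss sums are not evaluated. Two facts determine `N_w` up to a sign: `N_w + N_{νw} = 2r` for a
nonsquare `ν` of `F` (`traceSqCount_add_nonsquare`), and the second moment `∑ N_w(c) ^ 2 = q + (q -
1) r` (`sum_sq_traceSqCount`). The parity of `m` decides whether `ν` can be taken in the prime field
(`sum_quadratic_words_odd`) or all of the prime field consists of squares of `F`
(`sum_quadratic_words_even`). The undetermined sign is harmless, because changing the sign of `ε` or
`δ` only permutes the rows of the tables. -/

/-! ### Weight distributions from sums; equidistribution and squares in finite fields. -/

/-- A weight distribution is determined by the sums over the code of all functions of the weight. -/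
theorem hasWeightDistribution_of_sum {K ι X : Type*} [Field K] [DecidableEq K] [Fintype ι]
    [Fintype X] (C : Submodule K (ι → K)) (T : List (ℂ × ℂ)) (f : X → ι → K)
    (hf : Function.Injective f) (hC : ∀ c, c ∈ C ↔ ∃ x, f x = c) (hT : (T.map Prod.fst).Nodup)
    (hnat : ∀ r ∈ T, ∃ w : ℕ, (w : ℂ) = r.1)
    (hsum : ∀ g : ℂ → ℂ,
      ∑ x, g (hammingNorm (f x) : ℕ) = (T.map fun r => r.2 * g r.1).sum) :
    HasWeightDistribution C T := by
  have key : ∀ w : ℕ, (weightCount C w : ℂ) =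
      (T.map fun r => r.2 * if r.1 = (w : ℂ) then 1 else 0).sum := by
    intro w
    -- The test function is the indicator of the weight `w`.
    rw [← hsum fun z => if z = (w : ℂ) then 1 else 0]
    have h1 : {c : ι → K | c ∈ C ∧ hammingNorm c = w} =
        f '' (({x | hammingNorm (f x) = w} : Finset X) : Set X) := by
      ext c
      simp only [Set.mem_ofPred_eq, hC, Set.mem_image, Finset.coe_filter, Finset.mem_univ, true_and]
      constructor
      · rintro ⟨⟨x, rfl⟩, h⟩
        exact ⟨x, h, rfl⟩
      · rintro ⟨x, h, rfl⟩
        exact ⟨⟨x, rfl⟩, h⟩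
    rw [weightCount, h1, Set.ncard_image_of_injective _ hf, Set.ncard_coe_finset]
    simp [Finset.sum_boole]
  have row : ∀ T : List (ℂ × ℂ), (T.map Prod.fst).Nodup → ∀ r ∈ T,
      (T.map fun s => s.2 * if s.1 = r.1 then (1 : ℂ) else 0).sum = r.2 := by
    intro T hT
    induction T with
    | nil => simp
    | cons a T ih =>
      rw [List.map_cons, List.nodup_cons] at hT
      intro r hr
      rw [List.map_cons, List.sum_cons]
      rcases List.mem_cons.1 hr with rfl | hr
      · rw [List.sum_eq_zero]
        · simp
        · intro x hx
          obtain ⟨s, hs, rfl⟩ := List.mem_map.1 hx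
          have : s.1 ≠ r.1 := fun h => hT.1 (h ▸ List.mem_map_of_mem hs)
          simp [this]
      · have : a.1 ≠ r.1 := fun h => hT.1 (h ▸ List.mem_map_of_mem hr)
        rw [ih hT.2 r hr, if_neg this, mul_zero, zero_add]
  refine ⟨hT, fun r hr => ?_, fun w hw => ?_⟩
  · obtain ⟨w, hw⟩ := hnat r hr
    exact ⟨w, hw, by rw [key, hw, row T hT r hr]⟩
  · by_contra! h
    apply hw
    rw [← Nat.cast_eq_zero (R := ℂ), key]
    apply List.sum_eq_zero
    intro x hx
    obtain ⟨s, hs, rfl⟩ := List.mem_map.1 hx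
    simp [(h s hs).symm]

/-- A nonzero linear functional on a finite vector space is equidistributed. -/
theorem card_mul_sum_comp_functional {K V : Type*} [Field K] [Fintype K] [AddCommGroup V]
    [Module K V] [Fintype V] (l : V →ₗ[K] K) (hl : l ≠ 0) (k : K → ℂ) :
    (Fintype.card K : ℂ) * ∑ z, k (l z) = Fintype.card V * ∑ c, k c := by
  obtain ⟨z₀, hz₀⟩ : ∃ z₀, l z₀ = 1 := by
    obtain ⟨z, hz⟩ := DFunLike.ne_iff.1 hl
    exact ⟨(l z)⁻¹ • z, by simpa using inv_mul_cancel₀ hz⟩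
  -- Averaging over translations along `z₀`, each of which shifts `l` by `t`.
  calc (Fintype.card K : ℂ) * ∑ z, k (l z) = ∑ t : K, ∑ z, k (l (z + t • z₀)) := by
        rw [← Finset.card_univ, ← nsmul_eq_mul, ← Finset.sum_const]
        exact Finset.sum_congr rfl fun t _ =>
          (Fintype.sum_equiv (Equiv.addRight (t • z₀)) _ _ fun z => rfl).symm
    _ = ∑ z, ∑ t : K, k (l z + t) := by
        rw [Finset.sum_comm]
        simp [hz₀]
    _ = ∑ z : V, ∑ c, k c :=
        Finset.sum_congr rfl fun z _ => Fintype.sum_equiv (Equiv.addLeft (l z)) _ _ fun t => rfl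
    _ = Fintype.card V * ∑ c, k c := by simp

/-- The values of `z ^ 2` and `ν * z ^ 2`, for a nonsquare `ν`, cover the field twice. -/
theorem sum_sq_add_sum_nonsquare_mul_sq {F : Type*} [Field F] [Fintype F] [DecidableEq F]
    (hF : ringChar F ≠ 2) {ν : F} (hν : ¬ IsSquare ν) (k : F → ℂ) :
    ∑ z, k (z ^ 2) + ∑ z, k (ν * z ^ 2) = 2 * ∑ z, k z := by
  have hν0 : ν ≠ 0 := by rintro rfl; exact hν (IsSquare.zero)
  -- `y` has `1 + χ(y)` square roots; multiplication by `ν` flips `χ`, so the two character sums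
  -- cancel.
  have sq : ∀ k : F → ℂ, ∑ z, k (z ^ 2) = ∑ y, (1 + (quadraticChar F y : ℂ)) * k y := by
    intro k
    rw [← Finset.sum_fiberwise (s := Finset.univ) (g := fun z : F => z ^ 2)]
    refine Finset.sum_congr rfl fun y _ => ?_
    rw [Finset.sum_congr rfl (g := fun _ => k y)
      (fun z hz => by rw [(Finset.mem_filter.1 hz).2]), Finset.sum_const, nsmul_eq_mul]
    have h := quadraticChar_card_sqrts hF y
    have h2 : {x : F | x ^ 2 = y}.toFinset = ({x | x ^ 2 = y} : Finset F) := by ext; simp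
    rw [h2] at h
    congr 1
    rw [add_comm]
    exact_mod_cast h
  rw [sq, sq fun y => k (ν * y)]
  have h2 : ∑ y, (1 + (quadraticChar F y : ℂ)) * k (ν * y) =
      ∑ y, (1 - (quadraticChar F y : ℂ)) * k y := by
    refine Fintype.sum_equiv (Equiv.mulLeft₀ ν hν0) _ _ fun y => ?_
    rw [Equiv.mulLeft₀_apply, map_mul, quadraticChar_neg_one_iff_not_isSquare.2 hν]
    push_cast
    ring
  rw [h2, ← Finset.sum_add_distrib, Finset.mul_sum]
  exact Finset.sum_congr rfl fun y _ => by ring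

theorem ringChar_ne_two_of_card {F : Type*} [Field F] [Fintype F] (h : Odd (Fintype.card F)) :
    ringChar F ≠ 2 := by
  intro h2
  exact (Nat.not_even_iff_odd.2 h) (Nat.even_iff.2 (FiniteField.even_card_of_char_two h2))

/-! ### Subfield codes as trace codes. -/

section TraceCode

variable {K F κ ι β : Type*} [Field K] [Field F] [Algebra K F] [FiniteDimensional K F]
  [Algebra.IsSeparable K F]

/-- Every linear functional is of the form `x ↦ Tr (θ x)`. -/
theorem exists_trace_mul_eq (l : F →ₗ[K] K) : ∃ θ : F, ∀ x, l x = Algebra.trace K F (θ * x) := by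
  refine ⟨((Algebra.traceForm K F).toDual (traceForm_nondegenerate K F)).symm l, fun x => ?_⟩
  rw [← Algebra.traceForm_apply, LinearMap.BilinForm.apply_toDual_symm_apply]

theorem exists_trace_mul_ne_zero {a : F} (ha : a ≠ 0) : ∃ x, Algebra.trace K F (a * x) ≠ 0 := by
  by_contra! h
  exact ha ((traceForm_nondegenerate K F).1 a h)

/-- The subfield code is the trace code. -/
theorem mem_subfieldCode_iff (b : Module.Basis β K F) (G : Matrix κ ι F) (c : ι → K) :
    c ∈ subfieldCode b G ↔ ∃ d ∈ rowCode G, (fun s => Algebra.trace K F (d s)) = c := by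
  have : Finite β := Module.Finite.finite_basis b
  have := Fintype.ofFinite β
  constructor
  · intro hc
    induction hc using Submodule.span_induction with
    | mem c hc =>
      obtain ⟨⟨i, j⟩, rfl⟩ := hc
      obtain ⟨θ, hθ⟩ := exists_trace_mul_eq (b.coord j)
      refine ⟨θ • G i, Submodule.smul_mem _ _ (Submodule.subset_span ⟨i, rfl⟩), ?_⟩
      funext s
      simp [expandMatrix, ← hθ]
    | zero => exact ⟨0, zero_mem _, by funext s; simp⟩
    | add x y _ _ hx hy =>
      obtain ⟨d, hd, rfl⟩ := hx
      obtain ⟨e, he, rfl⟩ := hy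
      exact ⟨d + e, add_mem hd he, by funext s; simp⟩
    | smul t x _ hx =>
      obtain ⟨d, hd, rfl⟩ := hx
      refine ⟨algebraMap K F t • d, Submodule.smul_mem _ _ hd, ?_⟩
      funext s
      simp [← Algebra.smul_def]
  · rintro ⟨d, hd, rfl⟩
    -- The subfield code is only `K`-linear; quantifying over `θ` lets the induction absorb scalars
    -- from `F`.
    have key : ∀ θ : F, (fun s => Algebra.trace K F (θ * d s)) ∈ subfieldCode b G := by
      induction hd using Submodule.span_induction with
      | mem d hd =>
        obtain ⟨i, rfl⟩ := hd
        intro θ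
        have : (fun s => Algebra.trace K F (θ * G i s)) =
            ∑ j, Algebra.trace K F (θ * b j) • expandMatrix b G (i, j) := by
          funext s
          conv_lhs => rw [← b.sum_repr (G i s), Finset.mul_sum, map_sum]
          simp [expandMatrix, mul_comm]
        rw [this]
        exact Submodule.sum_mem _ fun j _ =>
          Submodule.smul_mem _ _ (Submodule.subset_span ⟨(i, j), rfl⟩)
      | zero => 
        intro θ
        convert zero_mem (subfieldCode b G) using 1
        funext s
        simp
      | add x y _ _ hx hy =>
        intro θ
        convert add_mem (hx θ) (hy θ) using 1
        funext s
        simp [mul_add]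
      | smul t x _ hx =>
        intro θ
        convert hx (θ * t) using 1
        funext s
        simp [mul_assoc]
    simpa using key 1

end TraceCode

/-! ### Parametrization of the trace code of the quadric. -/

section QuadricTraceCode

variable (K F : Type*) [Field K] [Field F] [Algebra K F]

/-- The word with coordinates `Tr (u z + v y + w z ^ 2) + h`, `z = x + y / 2`, at the affine points
`(x, y)`, and `Tr w` at infinity. -/
noncomputable def quadricTraceWord : F × F × F × K →ₗ[K] Option (F × F) → K where
  toFun t s := match s with
    | some (x, y) => Algebra.trace K F (t.1 * (x + 2⁻¹ * y) + t.2.1 * y +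
        t.2.2.1 * (x + 2⁻¹ * y) ^ 2) + t.2.2.2
    | none => Algebra.trace K F t.2.2.1
  map_add' t t' := by
    funext s
    rcases s with _ | ⟨x, y⟩
    · simp
    · simp only [Prod.fst_add, Prod.snd_add, add_mul, map_add, Pi.add_apply]
      ring
  map_smul' a t := by
    funext s
    rcases s with _ | ⟨x, y⟩
    · simp
    · simp [mul_add]

theorem quadricTraceWord_some (u v w : F) (h : K) (x y : F) :
    quadricTraceWord K F (u, v, w, h) (some (x, y)) =
      Algebra.trace K F (u * (x + 2⁻¹ * y) + v * y + w * (x + 2⁻¹ * y) ^ 2) + h := rfl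

theorem quadricTraceWord_none (u v w : F) (h : K) :
    quadricTraceWord K F (u, v, w, h) none = Algebra.trace K F w := rfl

variable {K F} [FiniteDimensional K F] [Algebra.IsSeparable K F]

theorem quadricTraceWord_injective (h2 : (2 : F) ≠ 0) :
    Function.Injective (quadricTraceWord K F) := by
  rw [injective_iff_map_eq_zero]
  rintro ⟨u, v, w, h⟩ h0
  have ev : ∀ z y, Algebra.trace K F (u * z + v * y + w * z ^ 2) + h = 0 := fun z y => by
    have := congrFun h0 (some (z - 2⁻¹ * y, y))
    rw [quadricTraceWord_some] at this
    simpa using this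
  have hh : h = 0 := by simpa using ev 0 0
  subst hh
  have hv : v = 0 := by
    by_contra hv
    obtain ⟨y, hy⟩ := exists_trace_mul_ne_zero (K := K) hv
    exact hy (by simpa using ev 0 y)
  subst hv
  have hw : w = 0 := by
    by_contra hw
    obtain ⟨y, hy⟩ := exists_trace_mul_ne_zero (K := K) (mul_ne_zero h2 hw)
    apply hy
    have e1 := ev (y + 1) 0
    have e2 := ev y 0
    have e3 := ev 1 0
    -- Polarization isolates the quadratic coefficient from the linear one.
    have : 2 * w * y = (u * (y + 1) + 0 * 0 + w * (y + 1) ^ 2) - (u * y + 0 * 0 + w * y ^ 2) -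
      (u * 1 + 0 * 0 + w * 1 ^ 2) := by ring
    rw [this, map_sub, map_sub]
    linear_combination e1 - e2 - e3
  subst hw
  have hu : u = 0 := by
    by_contra hu
    obtain ⟨y, hy⟩ := exists_trace_mul_ne_zero (K := K) hu
    exact hy (by simpa using ev y 0)
  subst hu
  rfl

theorem mem_subfieldCode_quadricCode_iff {κ β : Type*} (h2 : (2 : F) ≠ 0)
    (b : Module.Basis β K F) (G : Matrix κ (Option (F × F)) F)
    (hG : rowCode G = quadricCode (4⁻¹ : F)) (c : Option (F × F) → K) :
    c ∈ subfieldCode b G ↔ ∃ t, quadricTraceWord K F t = c := by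
  have h4 : (4 : F)⁻¹ = 2⁻¹ ^ 2 := by rw [inv_pow]; norm_num
  rw [mem_subfieldCode_iff, hG]
  constructor
  · rintro ⟨d, hd, rfl⟩
    obtain ⟨a, rfl⟩ := (Submodule.mem_span_range_iff_exists_fun F).1 hd
    -- From `x = z - y/2`: `a₀ x + a₁ y = a₀ z + (a₁ - a₀/2) y`.
    refine ⟨(a 0, a 1 - a 0 * 2⁻¹, a 2, Algebra.trace K F (a 3)), ?_⟩
    funext s
    rcases s with _ | ⟨x, y⟩
    · simp [quadricTraceWord_none, Fin.sum_univ_four, quadricMatrix, quadricPoint]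
    · rw [quadricTraceWord_some, ← map_add]
      congr 1
      simp only [Fin.sum_univ_four, quadricMatrix, quadricPoint, Matrix.of_apply, Pi.add_apply,
        Pi.smul_apply, smul_eq_mul, Matrix.cons_val, h4]
      field_simp
      ring
  · rintro ⟨⟨u, v, w, h⟩, rfl⟩
    obtain ⟨η, rfl⟩ := Algebra.trace_surjective K F h
    refine ⟨∑ i, ![u, v + u * 2⁻¹, w, η] i • quadricMatrix (4⁻¹ : F) i,
      Submodule.sum_mem _ fun i _ => Submodule.smul_mem _ _ (Submodule.subset_span ⟨i, rfl⟩), ?_⟩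
    funext s
    rcases s with _ | ⟨x, y⟩
    · simp [quadricTraceWord_none, Fin.sum_univ_four, quadricMatrix, quadricPoint]
    · rw [quadricTraceWord_some, ← map_add]
      congr 1
      simp only [Fin.sum_univ_four, quadricMatrix, quadricPoint, Matrix.of_apply, Pi.add_apply,
        Pi.smul_apply, smul_eq_mul, Matrix.cons_val, h4]
      field_simp
      ring

end QuadricTraceCode

/-! ### Values of `Tr (w z ^ 2)` and weights of individual words. -/

section Counting

variable {K F : Type*} [Field K] [Fintype K] [DecidableEq K] [Field F] [Fintype F] [Algebra K F]

/-- The number of `z` with `Tr (w z ^ 2) = c`. -/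
noncomputable def traceSqCount (w : F) (c : K) : ℕ :=
  Finset.card {z : F | Algebra.trace K F (w * z ^ 2) = c}

omit [Fintype K] in
theorem cast_traceSqCount (w : F) (c : K) : (traceSqCount w c : ℂ) =
    ∑ z : F, if Algebra.trace K F (w * z ^ 2) = c then 1 else 0 := by
  rw [Finset.sum_boole, traceSqCount]

theorem sum_traceSqCount (w : F) : ∑ c : K, (traceSqCount w c : ℂ) = Fintype.card F := by
  simp_rw [cast_traceSqCount]
  rw [Finset.sum_comm]
  simp

omit [Fintype K] in
theorem traceSqCount_mul_sq (w : F) (c : K) {μ : F} (hμ : μ ≠ 0) :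
    traceSqCount (w * μ ^ 2) c = traceSqCount w c := by
  rw [← Nat.cast_inj (R := ℂ), cast_traceSqCount, cast_traceSqCount]
  refine Fintype.sum_equiv (Equiv.mulLeft₀ μ hμ) _ _ fun z => ?_
  simp [mul_pow, mul_assoc]

omit [Fintype K] in
theorem traceSqCount_algebraMap_mul (w : F) (c : K) {l : K} (hl : l ≠ 0) :
    traceSqCount (algebraMap K F l * w) (l * c) = traceSqCount w c := by
  simp [traceSqCount, ← Algebra.smul_def, hl]

variable {r : ℕ} (hr : Fintype.card F = Fintype.card K * r)
include hr

omit [DecidableEq K] in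
theorem sum_comp_trace_mul {a : F} (ha : a ≠ 0) (k : K → ℂ) :
    ∑ z, k (Algebra.trace K F (a * z)) = r * ∑ c, k c := by
  have hK : (Fintype.card K : ℂ) ≠ 0 := Nat.cast_ne_zero.2 Fintype.card_ne_zero
  apply mul_left_cancel₀ hK
  obtain ⟨x, hx⟩ := exists_trace_mul_ne_zero (K := K) ha
  have := card_mul_sum_comp_functional ((Algebra.trace K F).comp (LinearMap.mulLeft K a))
    (DFunLike.ne_iff.2 ⟨x, by simpa using hx⟩) k
  simp only [LinearMap.comp_apply, LinearMap.mulLeft_apply] at this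
  rw [this, hr]
  push_cast
  ring

/-- The second moment counts pairs `(z, z + d)` with equal trace. For `d ≠ 0` the condition is
affine and nonconstant in `z`, hence has `r` solutions. -/
theorem sum_sq_traceSqCount (h2 : (2 : F) ≠ 0) {w : F} (hw : w ≠ 0) :
    ∑ c : K, (traceSqCount w c : ℂ) ^ 2 = Fintype.card F + (Fintype.card F - 1) * r := by
  classical
  calc ∑ c : K, (traceSqCount w c : ℂ) ^ 2
      = ∑ z : F, ∑ z' : F, if Algebra.trace K F (w * z' ^ 2) = Algebra.trace K F (w * z ^ 2)
          then 1 else 0 := by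
        simp_rw [sq, cast_traceSqCount, Finset.sum_mul_sum]
        rw [Finset.sum_comm]
        refine Finset.sum_congr rfl fun z _ => ?_
        rw [Finset.sum_comm]
        refine Finset.sum_congr rfl fun z' _ => ?_
        simp only [mul_ite, mul_one, mul_zero, Finset.sum_ite_eq, Finset.mem_univ, if_true,
          ← pow_two]
        exact if_congr eq_comm rfl rfl
    _ = ∑ z : F, ∑ d : F, if Algebra.trace K F (2 * w * d * z) +
          Algebra.trace K F (w * d ^ 2) = 0 then 1 else 0 := by
        refine Finset.sum_congr rfl fun z _ => ?_
        refine (Fintype.sum_equiv (Equiv.addLeft z) _ _ fun d => ?_).symm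
        refine if_congr ?_ rfl rfl
        rw [← map_add, Equiv.coe_addLeft, ← sub_eq_zero (a := Algebra.trace K F (w * (z + d) ^ 2)),
          ← map_sub]
        ring_nf
    _ = ∑ d : F, if d = 0 then (Fintype.card F : ℂ) else r := by
        rw [Finset.sum_comm]
        refine Finset.sum_congr rfl fun d _ => ?_
        split_ifs with hd
        · simp [hd]
        · rw [sum_comp_trace_mul hr (mul_ne_zero (mul_ne_zero h2 hw) hd)
            fun c => if c + Algebra.trace K F (w * d ^ 2) = 0 then (1 : ℂ) else 0]
          simp [add_eq_zero_iff_eq_neg]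
    _ = Fintype.card F + (Fintype.card F - 1) * r := by
        rw [Fintype.sum_eq_add_sum_compl 0, if_pos rfl, Finset.sum_congr rfl (g := fun _ => (r : ℂ))
          (fun d hd => if_neg (by simpa using hd))]
        simp [Finset.card_compl, Nat.cast_sub (Nat.one_le_iff_ne_zero.2 Fintype.card_ne_zero)]

omit [Fintype K] hr in
theorem cast_hammingNorm_quadricTraceWord (u v w : F) (h : K) :
    (hammingNorm (quadricTraceWord K F (u, v, w, h)) : ℂ) =
      (if Algebra.trace K F w = 0 then 0 else 1) +
      ∑ z : F, ∑ y : F, if Algebra.trace K F (u * z + v * y + w * z ^ 2) + h = 0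
        then 0 else 1 := by
  have : (hammingNorm (quadricTraceWord K F (u, v, w, h)) : ℂ) =
      ∑ s, if quadricTraceWord K F (u, v, w, h) s = 0 then 0 else 1 := by
    rw [hammingNorm, ← Finset.sum_boole]
    simp [ite_not]
  rw [this, Fintype.sum_option, quadricTraceWord_none, Fintype.sum_prod_type, Finset.sum_comm]
  congr 1
  conv_rhs => rw [Finset.sum_comm]
  refine Finset.sum_congr rfl fun y _ => ?_
  exact Fintype.sum_equiv (Equiv.addRight (2⁻¹ * y)) _ _ fun x => by
    rw [quadricTraceWord_some]; rfl

theorem cast_hammingNorm_of_ne_zero (u : F) {v : F} (hv : v ≠ 0) (w : F) (h : K) :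
    (hammingNorm (quadricTraceWord K F (u, v, w, h)) : ℂ) =
      (if Algebra.trace K F w = 0 then 0 else 1) + Fintype.card F * (Fintype.card F - r) := by
  rw [cast_hammingNorm_quadricTraceWord]
  congr 1
  have : ∀ z : F, ∑ y : F, (if Algebra.trace K F (u * z + v * y + w * z ^ 2) + h = 0
      then (0 : ℂ) else 1) = Fintype.card F - r := by
    intro z
    have e : ∀ y, Algebra.trace K F (u * z + v * y + w * z ^ 2) + h =
        Algebra.trace K F (v * y) + (Algebra.trace K F (u * z + w * z ^ 2) + h) := fun y => by
      rw [← add_assoc, ← map_add]; ring_nf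
    simp_rw [e]
    rw [sum_comp_trace_mul hr hv fun c =>
      if c + (Algebra.trace K F (u * z + w * z ^ 2) + h) = 0 then (0 : ℂ) else 1]
    simp_rw [add_eq_zero_iff_eq_neg]
    have : ∀ a : K, ∑ c, (if c = a then (0 : ℂ) else 1) = Fintype.card K - 1 := fun a => by
      have : ∀ c, (if c = a then (0 : ℂ) else 1) = 1 - if c = a then 1 else 0 := fun c => by
        split_ifs <;> simp
      simp_rw [this, Finset.sum_sub_distrib]
      simp
    rw [this, hr]
    push_cast
    ring
  simp only [this]
  simp [mul_sub]

theorem cast_hammingNorm_of_zero_zero {u : F} (hu : u ≠ 0) (h : K) :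
    (hammingNorm (quadricTraceWord K F (u, 0, 0, h)) : ℂ) =
      Fintype.card F * (Fintype.card F - r) := by
  have h1 := cast_hammingNorm_of_ne_zero hr 0 hu 0 h
  -- For `w = 0` the variables `z` and `y` play symmetric roles, so this is the case `v ≠ 0` with
  -- the two exchanged.
  rw [cast_hammingNorm_quadricTraceWord, Finset.sum_comm] at h1
  rw [cast_hammingNorm_quadricTraceWord]
  simpa using h1

omit [Fintype K] hr in
theorem cast_hammingNorm_const (h : K) :
    (hammingNorm (quadricTraceWord K F (0, 0, 0, h)) : ℂ) =
      if h = 0 then 0 else (Fintype.card F : ℂ) ^ 2 := by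
  rw [cast_hammingNorm_quadricTraceWord]
  split_ifs <;> simp_all [sq]

-- Completing the square with the shift `z + u / (2w)`; the factor `q` comes from the free variable
-- `y`.
omit [Fintype K] hr in
theorem cast_hammingNorm_of_zero (h2 : (2 : F) ≠ 0) (u : F) {w : F} (hw : w ≠ 0) (h : K) :
    (hammingNorm (quadricTraceWord K F (u, 0, w, h)) : ℂ) =
      Fintype.card F * (Fintype.card F -
        traceSqCount w (Algebra.trace K F (u ^ 2 * (4 * w)⁻¹) - h)) +
      (if Algebra.trace K F w = 0 then 0 else 1) := by
  rw [cast_hammingNorm_quadricTraceWord, add_comm]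
  congr 1
  simp only [zero_mul, add_zero, Finset.sum_const, Finset.card_univ, nsmul_eq_mul]
  rw [← Finset.mul_sum, cast_traceSqCount]
  congr 1
  have h4 : (4 : F) ≠ 0 := by
    have : (4 : F) = 2 * 2 := by norm_num
    rw [this]; exact mul_ne_zero h2 h2
  rw [eq_sub_iff_add_eq]
  rw [← Fintype.sum_equiv (Equiv.addRight (u * (2 * w)⁻¹)) _
    (fun z => if Algebra.trace K F (w * z ^ 2) = Algebra.trace K F (u ^ 2 * (4 * w)⁻¹) - h
      then (1 : ℂ) else 0) (fun z => rfl), ← Finset.sum_add_distrib]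
  have : ∀ z : F, (Algebra.trace K F (w * (z + u * (2 * w)⁻¹) ^ 2) =
      Algebra.trace K F (u ^ 2 * (4 * w)⁻¹) - h) ↔
      Algebra.trace K F (u * z + w * z ^ 2) + h = 0 := by
    intro z
    have : w * (z + u * (2 * w)⁻¹) ^ 2 = (u * z + w * z ^ 2) + u ^ 2 * (4 * w)⁻¹ := by
      field_simp
      ring
    rw [this, map_add]
    constructor
    · intro H; linear_combination H
    · intro H; linear_combination H
  simp only [Equiv.coe_addRight, this]
  rw [Finset.sum_congr rfl (g := fun _ => (1 : ℂ)) (fun z _ => by split_ifs <;> simp)]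
  simp

end Counting

/-! ### Sums over the whole code, and the quadratic words for either parity. -/

section Counting

variable {K F : Type*} [Field K] [Fintype K] [DecidableEq K] [Field F] [Fintype F] [Algebra K F]

theorem sum_ite_eq_zero (a b : ℂ) :
    ∑ c : K, (if c = 0 then a else b) = a + (Fintype.card K - 1) * b := by
  rw [Fintype.sum_eq_add_sum_compl 0, if_pos rfl, Finset.sum_congr rfl (g := fun _ => b)
    (fun d hd => if_neg (by simpa using hd))]
  simp [Finset.card_compl, Nat.cast_sub (Nat.one_le_iff_ne_zero.2 Fintype.card_ne_zero)]

variable {r : ℕ} (hr : Fintype.card F = Fintype.card K * r)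
include hr

theorem sum_comp_trace_eq_zero (f : ℂ → ℂ) :
    ∑ w : F, f (if Algebra.trace K F w = 0 then 0 else 1) =
      r * f 0 + (Fintype.card F - r) * f 1 := by
  have h := sum_comp_trace_mul hr one_ne_zero fun c : K => f (if c = 0 then 0 else 1)
  simp only [one_mul, apply_ite f, sum_ite_eq_zero] at h
  simp only [apply_ite f, h, hr]
  push_cast
  ring

theorem sum_hammingNorm_quadricTraceWord [DecidableEq F] (h2 : (2 : F) ≠ 0) (g : ℂ → ℂ) :
    ∑ t : F × F × F × K, g (hammingNorm (quadricTraceWord K F t) : ℕ) =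
      (Fintype.card F - 1) * Fintype.card F * Fintype.card K *
        (r * g (Fintype.card F * (Fintype.card F - r)) +
          (Fintype.card F - r) * g (Fintype.card F * (Fintype.card F - r) + 1)) +
      (g 0 + (Fintype.card K - 1) * g ((Fintype.card F : ℂ) ^ 2) +
        (Fintype.card F - 1) * Fintype.card K * g (Fintype.card F * (Fintype.card F - r))) +
      Fintype.card F * ∑ w ∈ ({0}ᶜ : Finset F), ∑ c : K,
        g (Fintype.card F * (Fintype.card F - traceSqCount w c) +
          if Algebra.trace K F w = 0 then 0 else 1) := by
  have hF1 : (1 : ℕ) ≤ Fintype.card F := Nat.one_le_iff_ne_zero.2 Fintype.card_ne_zero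
  have generic : ∀ v ∈ ({0}ᶜ : Finset F), ∑ u : F, ∑ w : F, ∑ h : K,
      g (hammingNorm (quadricTraceWord K F (u, v, w, h)) : ℕ) =
      Fintype.card F * Fintype.card K * (r * g (Fintype.card F * (Fintype.card F - r)) +
        (Fintype.card F - r) * g (Fintype.card F * (Fintype.card F - r) + 1)) := by
    intro v hv
    have hv : v ≠ 0 := by simpa using hv
    simp_rw [cast_hammingNorm_of_ne_zero hr _ hv]
    simp only [Finset.sum_const, Finset.card_univ, nsmul_eq_mul, ← Finset.mul_sum]
    rw [sum_comp_trace_eq_zero hr fun x => g (x + Fintype.card F * (Fintype.card F - r)),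
      zero_add, add_comm (1 : ℂ)]
    ring
  have zero : ∑ u : F, ∑ h : K, g (hammingNorm (quadricTraceWord K F (u, 0, 0, h)) : ℕ) =
      g 0 + (Fintype.card K - 1) * g ((Fintype.card F : ℂ) ^ 2) +
        (Fintype.card F - 1) * Fintype.card K * g (Fintype.card F * (Fintype.card F - r)) := by
    rw [Fintype.sum_eq_add_sum_compl 0]
    simp_rw [cast_hammingNorm_const, apply_ite g, sum_ite_eq_zero]
    congr 1
    rw [Finset.sum_congr rfl (g := fun _ => (Fintype.card K : ℂ) *
      g (Fintype.card F * (Fintype.card F - r)))]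
    · simp [Finset.card_compl, Nat.cast_sub hF1, mul_assoc]
    · intro u hu
      have hu : u ≠ 0 := by simpa using hu
      simp_rw [cast_hammingNorm_of_zero_zero hr hu]
      simp
  have quad : ∀ w ∈ ({0}ᶜ : Finset F), ∑ u : F, ∑ h : K,
      g (hammingNorm (quadricTraceWord K F (u, 0, w, h)) : ℕ) =
      Fintype.card F * ∑ c : K, g (Fintype.card F * (Fintype.card F - traceSqCount w c) +
          if Algebra.trace K F w = 0 then 0 else 1) := by
    intro w hw
    have hw : w ≠ 0 := by simpa using hw
    simp_rw [cast_hammingNorm_of_zero h2 _ hw]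
    rw [Finset.sum_congr rfl (g := fun _ => ∑ c : K,
      g (Fintype.card F * (Fintype.card F - traceSqCount w c) +
        if Algebra.trace K F w = 0 then 0 else 1))]
    · simp
    · intro u _
      -- For fixed `u` and `w`, the value `c` is a bijective function of `h`, so `u` contributes
      -- only a factor `q`.
      exact Fintype.sum_equiv (Equiv.subLeft (Algebra.trace K F (u ^ 2 * (4 * w)⁻¹))) _ _
        fun h => rfl
  simp only [Fintype.sum_prod_type]
  rw [Finset.sum_comm, Fintype.sum_eq_add_sum_compl 0, Finset.sum_congr rfl generic,
    Finset.sum_comm, Fintype.sum_eq_add_sum_compl 0, zero, Finset.sum_congr rfl quad,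
    ← Finset.mul_sum]
  simp only [Finset.sum_const, Finset.card_compl, Finset.card_singleton, nsmul_eq_mul,
    Nat.cast_sub hF1, Nat.cast_one]
  ring

theorem traceSqCount_add_nonsquare [DecidableEq F] (hF : ringChar F ≠ 2) {ν : F}
    (hν : ¬ IsSquare ν) {w : F} (hw : w ≠ 0) (c : K) :
    (traceSqCount w c : ℂ) + traceSqCount (ν * w) c = 2 * r := by
  have h := sum_sq_add_sum_nonsquare_mul_sq hF hν
    fun z => if Algebra.trace K F (w * z) = c then (1 : ℂ) else 0
  rw [sum_comp_trace_mul hr hw fun a => if a = c then (1 : ℂ) else 0] at h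
  simp only [Finset.sum_ite_eq', Finset.mem_univ, if_true, mul_one] at h
  rw [← h, cast_traceSqCount, cast_traceSqCount]
  congr 1
  refine Finset.sum_congr rfl fun z _ => ?_
  rw [mul_left_comm, mul_assoc]

/-- With `ν` in `K`, scaling gives `N_{νw}(νc) = N_w(c)`. Hence `N_w(0) = r`, and the values at
square and nonsquare `c` are `r ± s` in some order. Every `w ≠ 0` has the same distribution of
values, so only the count of `w` with `Tr w = 0` remains. -/
theorem sum_quadratic_words_odd [DecidableEq F] (h2 : (2 : F) ≠ 0) (hF : ringChar F ≠ 2)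
    (hK : ringChar K ≠ 2) {ν : K} (hν : ¬ IsSquare (algebraMap K F ν)) {s : ℂ} (hs : s ^ 2 = r)
    (g : ℂ → ℂ) :
    ∑ w ∈ ({0}ᶜ : Finset F), ∑ c : K, g (Fintype.card F * (Fintype.card F - traceSqCount w c) +
        if Algebra.trace K F w = 0 then 0 else 1) =
      (r - 1) * (g (Fintype.card F * (Fintype.card F - r)) + (Fintype.card K - 1) / 2 *
        (g (Fintype.card F * (Fintype.card F - r - s)) +
          g (Fintype.card F * (Fintype.card F - r + s)))) +
      (Fintype.card F - r) * (g (Fintype.card F * (Fintype.card F - r) + 1) +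
        (Fintype.card K - 1) / 2 * (g (Fintype.card F * (Fintype.card F - r - s) + 1) +
          g (Fintype.card F * (Fintype.card F - r + s) + 1))) := by
  have hK1 : (1 : ℕ) ≤ Fintype.card K := Nat.one_le_iff_ne_zero.2 Fintype.card_ne_zero
  have hνK : ¬ IsSquare ν := fun h => hν (h.map (algebraMap K F))
  have hν0 : ν ≠ 0 := by rintro rfl; simp at hνK
  have key : ∀ w : F, w ≠ 0 → ∀ f : ℂ → ℂ, ∑ c : K, f (traceSqCount w c) =
      f r + (Fintype.card K - 1) / 2 * (f (r + s) + f (r - s)) := by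
    intro w hw
    have sqs : ∀ (c l : K), l ≠ 0 → traceSqCount w (c * l ^ 2) = traceSqCount w c := by
      intro c l hl
      rw [← traceSqCount_algebraMap_mul w c (pow_ne_zero 2 hl),
        ← traceSqCount_mul_sq w _ ((map_ne_zero (algebraMap K F)).2 hl), map_pow, mul_comm w,
        mul_comm c]
    have expand : ∀ f : ℂ → ℂ, ∑ c : K, f (traceSqCount w c) = f (traceSqCount w (0 : K)) +
        (Fintype.card K - 1) / 2 *
          (f (traceSqCount w (1 : K)) + f (traceSqCount w ν)) := by
      intro f
      have h := sum_sq_add_sum_nonsquare_mul_sq hK hνK fun c => f (traceSqCount w c)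
      have h0 : ∀ c : K, ∑ l : K, f (traceSqCount w (c * l ^ 2)) = f (traceSqCount w (0 : K)) +
          (Fintype.card K - 1) * f (traceSqCount w c) := by
        intro c
        rw [Fintype.sum_eq_add_sum_compl 0, Finset.sum_congr rfl
          (g := fun _ => f (traceSqCount w c)) (fun l hl => by rw [sqs c l (by simpa using hl)])]
        simp [Finset.card_compl, Nat.cast_sub hK1]
      have h1 := h0 1
      simp only [one_mul] at h1
      rw [h1, h0 ν] at h
      linear_combination -h / 2
    have e0 : (traceSqCount w (0 : K) : ℂ) = r := by
      have h := traceSqCount_add_nonsquare hr hF hν hw 0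
      have h' := traceSqCount_algebraMap_mul w (0 : K) hν0
      rw [mul_zero] at h'
      rw [h'] at h
      linear_combination h / 2
    have e1 : (traceSqCount w ν : ℂ) = 2 * r - traceSqCount w (1 : K) := by
      have h := traceSqCount_add_nonsquare hr hF hν hw ν
      have h' := traceSqCount_algebraMap_mul w (1 : K) hν0
      rw [mul_one] at h'
      rw [h'] at h
      linear_combination h
    have mom := sum_sq_traceSqCount hr h2 hw
    have hcard : ((Fintype.card K : ℂ) - 1) ≠ 0 := by
      rw [sub_ne_zero, ← Nat.cast_one, Nat.cast_inj.ne]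
      exact Fintype.one_lt_card.ne'
    rw [expand (· ^ 2), e0, e1, hr] at mom
    -- The second moment reads `(|K| - 1) (N_w(1) - r) ^ 2 = (|K| - 1) r`.
    have ht : ((traceSqCount w (1 : K) : ℂ) - r) ^ 2 = s ^ 2 := by
      rw [hs]
      apply mul_left_cancel₀ hcard
      push_cast at mom
      linear_combination mom
    intro f
    rw [expand, e0, e1]
    rcases sq_eq_sq_iff_eq_or_eq_neg.1 ht with h | h
    · rw [show (traceSqCount w (1 : K) : ℂ) = r + s by linear_combination h]
      ring_nf
    · rw [show (traceSqCount w (1 : K) : ℂ) = r - s by linear_combination h]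
      ring_nf
  set S : ℂ → ℂ := fun e => g (Fintype.card F * (Fintype.card F - r) + e) +
    (Fintype.card K - 1) / 2 * (g (Fintype.card F * (Fintype.card F - r - s) + e) +
      g (Fintype.card F * (Fintype.card F - r + s) + e)) with hS
  rw [Finset.sum_congr rfl (g := fun w : F => S (if Algebra.trace K F w = 0 then 0 else 1))]
  · have h := sum_comp_trace_eq_zero hr S
    rw [Fintype.sum_eq_add_sum_compl 0, map_zero, if_pos rfl] at h
    -- Removing `w = 0`, which has trace zero, turns the multiplicity `r` into `r - 1`.
    rw [eq_sub_of_add_eq' h, hS]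
    simp only [add_zero]
    ring
  · intro w hw
    rw [key w (by simpa using hw) fun x => g (Fintype.card F * (Fintype.card F - x) +
        if Algebra.trace K F w = 0 then 0 else 1), hS]
    simp only [sub_sub, sub_add]

/-- As elements of `K` are squares in `F`, `N_w` is constant on `c ≠ 0`, and it depends only on the
square class of `w`. The coordinate at infinity is correlated with that class: among `w = z ^ 2` the
trace vanishes `N_1(0)` times, which is why the sign enters the multiplicities. The final `1/2`
arises because `z ^ 2` and `ν z ^ 2` cover each nonzero `w` twice. -/
theorem sum_quadratic_words_even [DecidableEq F] (h2 : (2 : F) ≠ 0) (hF : ringChar F ≠ 2)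
    (hsq : ∀ l : K, IsSquare (algebraMap K F l)) {s : ℂ} (hs : Fintype.card K * s ^ 2 = r)
    (g : ℂ → ℂ) :
    ∑ w ∈ ({0}ᶜ : Finset F), ∑ c : K, g (Fintype.card F * (Fintype.card F - traceSqCount w c) +
        if Algebra.trace K F w = 0 then 0 else 1) =
      ((r + (Fintype.card K - 1) * s - 1) *
          (g (Fintype.card F * (Fintype.card F - r - (Fintype.card K - 1) * s)) +
            (Fintype.card K - 1) * g (Fintype.card F * (Fintype.card F - r + s))) +
        (Fintype.card F - r - (Fintype.card K - 1) * s) *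
          (g (Fintype.card F * (Fintype.card F - r - (Fintype.card K - 1) * s) + 1) +
            (Fintype.card K - 1) * g (Fintype.card F * (Fintype.card F - r + s) + 1)) +
        (r - (Fintype.card K - 1) * s - 1) *
          (g (Fintype.card F * (Fintype.card F - r + (Fintype.card K - 1) * s)) +
            (Fintype.card K - 1) * g (Fintype.card F * (Fintype.card F - r - s))) +
        (Fintype.card F - r + (Fintype.card K - 1) * s) *
          (g (Fintype.card F * (Fintype.card F - r + (Fintype.card K - 1) * s) + 1) +
            (Fintype.card K - 1) * g (Fintype.card F * (Fintype.card F - r - s) + 1))) / 2 := by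
  have hK1 : (1 : ℕ) ≤ Fintype.card K := Nat.one_le_iff_ne_zero.2 Fintype.card_ne_zero
  have hcard : ((Fintype.card K : ℂ) - 1) ≠ 0 := by
    rw [sub_ne_zero, ← Nat.cast_one, Nat.cast_inj.ne]
    exact Fintype.one_lt_card.ne'
  have hcard0 : (Fintype.card K : ℂ) ≠ 0 := Nat.cast_ne_zero.2 Fintype.card_ne_zero
  obtain ⟨ν, hν⟩ := FiniteField.exists_nonsquare hF
  have hν0 : ν ≠ 0 := by rintro rfl; simp at hν
  have const : ∀ (w : F) (c : K), c ≠ 0 → traceSqCount w c = traceSqCount w (1 : K) := by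
    intro w c hc
    obtain ⟨μ, hμ⟩ := hsq c
    have hμ0 : μ ≠ 0 := by
      rintro rfl
      simp [hc] at hμ
    have h := traceSqCount_algebraMap_mul w (1 : K) hc
    rwa [mul_one, mul_comm, hμ, ← pow_two, traceSqCount_mul_sq w c hμ0] at h
  have expand : ∀ (w : F) (f : ℂ → ℂ), ∑ c : K, f (traceSqCount w c) =
      f (traceSqCount w (0 : K)) + (Fintype.card K - 1) * f (traceSqCount w (1 : K)) := by
    intro w f
    rw [Fintype.sum_eq_add_sum_compl 0, Finset.sum_congr rfl
      (g := fun _ => f (traceSqCount w (1 : K)))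
      (fun l hl => by rw [const w l (by simpa using hl)])]
    simp [Finset.card_compl, Nat.cast_sub hK1]
  -- `t` is the deviation from uniformity. The total forces `N_1(0) = r + (|K| - 1) t`, passing to
  -- `ν` replaces `t` by `-t`, and the second moment gives `t = ± s`.
  obtain ⟨t, ht⟩ : ∃ t : ℂ, (traceSqCount (1 : F) (1 : K) : ℂ) = r - t :=
    ⟨_, (sub_sub_cancel _ _).symm⟩
  have ht0 : (traceSqCount (1 : F) (0 : K) : ℂ) = r + (Fintype.card K - 1) * t := by
    have h := (expand 1 fun x => x).symm.trans (sum_traceSqCount (K := K) (1 : F))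
    rw [ht, hr] at h
    push_cast at h
    linear_combination h
  have htν : ∀ c : K, (traceSqCount ν c : ℂ) = 2 * r - traceSqCount (1 : F) c := by
    intro c
    have h := traceSqCount_add_nonsquare hr hF hν one_ne_zero c
    rw [mul_one] at h
    linear_combination h
  have hts : t ^ 2 = s ^ 2 := by
    have mom := sum_sq_traceSqCount hr h2 (one_ne_zero : (1 : F) ≠ 0)
    rw [expand 1 (· ^ 2), ht, ht0, hr] at mom
    push_cast at mom
    apply mul_left_cancel₀ hcard
    apply mul_left_cancel₀ hcard0
    linear_combination mom - (Fintype.card K - 1) * hs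
  have trsum : ∀ (w : F) (f : ℂ → ℂ),
      ∑ z ∈ ({0}ᶜ : Finset F), f (if Algebra.trace K F (w * z ^ 2) = 0 then 0 else 1) =
      (traceSqCount w (0 : K) - 1) * f 0 + (Fintype.card F - traceSqCount w (0 : K)) * f 1 := by
    intro w f
    have h : ∑ z : F, f (if Algebra.trace K F (w * z ^ 2) = 0 then 0 else 1) =
        traceSqCount w (0 : K) * f 0 + (Fintype.card F - traceSqCount w (0 : K)) * f 1 := by
      rw [cast_traceSqCount, sub_mul, Finset.sum_mul, Finset.sum_mul, ← Finset.card_univ, ← nsmul_eq_mul,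
        ← Finset.sum_const, ← Finset.sum_sub_distrib, ← Finset.sum_add_distrib]
      refine Finset.sum_congr rfl fun z _ => ?_
      split_ifs <;> simp
    rw [Fintype.sum_eq_add_sum_compl 0] at h
    simp only [ne_eq, OfNat.ofNat_ne_zero, not_false_eq_true, zero_pow, mul_zero, map_zero,
      if_true] at h
    linear_combination h
  set k : F → ℂ := fun w => ∑ c : K, g (Fintype.card F * (Fintype.card F - traceSqCount w c) +
        if Algebra.trace K F w = 0 then 0 else 1) with hk
  set S : ℂ → ℂ → ℂ := fun a e =>
    g (Fintype.card F * (Fintype.card F - r - (Fintype.card K - 1) * a) + e) +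
    (Fintype.card K - 1) * g (Fintype.card F * (Fintype.card F - r + a) + e) with hS
  have kval : ∀ (w : F) (a : ℂ), (traceSqCount w (0 : K) : ℂ) = r + (Fintype.card K - 1) * a →
      (traceSqCount w (1 : K) : ℂ) = r - a →
      ∑ z ∈ ({0}ᶜ : Finset F), k (w * z ^ 2) =
        (r + (Fintype.card K - 1) * a - 1) * S a 0 +
          (Fintype.card F - r - (Fintype.card K - 1) * a) * S a 1 := by
    intro w a h0 h1
    rw [Finset.sum_congr rfl
      (g := fun z => S a (if Algebra.trace K F (w * z ^ 2) = 0 then 0 else 1)), trsum, h0]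
    · ring
    · intro z hz
      have hz : z ≠ 0 := by simpa using hz
      simp only [hk, traceSqCount_mul_sq w _ hz]
      rw [expand w fun x => g (Fintype.card F * (Fintype.card F - x) +
        if Algebra.trace K F (w * z ^ 2) = 0 then 0 else 1), h0, h1, hS]
      simp only [sub_sub, sub_add]
  have hsum := sum_sq_add_sum_nonsquare_mul_sq hF hν k
  rw [Fintype.sum_eq_add_sum_compl 0, Fintype.sum_eq_add_sum_compl 0 fun z => k (ν * z ^ 2),
    Fintype.sum_eq_add_sum_compl 0 k, kval ν (-t) (by rw [htν, ht0]; ring) (by rw [htν, ht]; ring)]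
    at hsum
  have h1 := kval 1 t ht0 ht
  simp only [one_mul] at h1
  rw [h1] at hsum
  simp only [ne_eq, OfNat.ofNat_ne_zero, not_false_eq_true, zero_pow, mul_zero] at hsum
  have hres : ∑ w ∈ ({0}ᶜ : Finset F), k w =
      ((r + (Fintype.card K - 1) * t - 1) * S t 0 +
        (Fintype.card F - r - (Fintype.card K - 1) * t) * S t 1 +
        ((r - (Fintype.card K - 1) * t - 1) * S (-t) 0 +
          (Fintype.card F - r + (Fintype.card K - 1) * t) * S (-t) 1)) / 2 := by
    linear_combination -hsum / 2
  rw [hres]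
  -- The sign of `t` merely exchanges the contributions of squares and nonsquares.
  rcases sq_eq_sq_iff_eq_or_eq_neg.1 hts with h | h
  · simp only [h, hS, add_zero, mul_neg, sub_neg_eq_add, ← sub_eq_add_neg]
    ring
  · simp only [h, hS, add_zero, mul_neg, sub_neg_eq_add, ← sub_eq_add_neg, neg_neg]
    ring

end Counting

/-! ### Squares of the extension field lying in the prime field. -/

section PrimeField

variable {p : ℕ} [Fact p.Prime] {F : Type*} [Field F] [Fintype F] [Algebra (ZMod p) F]

/-- For `p = 2a + 1` this is the divisibility of `p ^ (2j) - 1` by `p ^ 2 - 1`. It makes `(p ^ (2j)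
- 1) / 2` a multiple of `p - 1`, as Euler's criterion requires. -/
theorem exists_pow_two_mul_eq (a j : ℕ) : ∃ d, (2 * a + 1) ^ (2 * j) = 1 + 4 * a * (a + 1) * d := by
  induction j with
  | zero => exact ⟨0, by simp⟩
  | succ j ih =>
    obtain ⟨d, hd⟩ := ih
    refine ⟨1 + (2 * a + 1) ^ 2 * d, ?_⟩
    rw [mul_add, pow_add, hd]
    ring

theorem isSquare_algebraMap_of_card_eq (hp : Odd p) {j : ℕ} (hF : Fintype.card F = p ^ (2 * j))
    (l : ZMod p) : IsSquare (algebraMap (ZMod p) F l) := by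
  by_cases hl : l = 0
  · simp [hl]
  rw [FiniteField.isSquare_iff
    (ringChar_ne_two_of_card (by rw [hF]; exact hp.pow)) (by simpa using hl), ← map_pow, hF]
  obtain ⟨a, ha⟩ := hp
  obtain ⟨d, hd⟩ := exists_pow_two_mul_eq a j
  have h : p ^ (2 * j) / 2 = (p - 1) * ((a + 1) * d) := by
    rw [ha, hd, Nat.add_sub_cancel,
      show 1 + 4 * a * (a + 1) * d = 1 + 2 * (2 * a * ((a + 1) * d)) by ring]
    omega
  rw [h, pow_mul, ZMod.pow_card_sub_one_eq_one hl, one_pow, map_one]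

/-- The Euler exponent of `F` is congruent to that of `ZMod p` modulo `p - 1`, so nonsquares of
`ZMod p` stay nonsquares. -/
theorem exists_not_isSquare_algebraMap_of_card_eq (hp : Odd p) {j : ℕ}
    (hF : Fintype.card F = p ^ (2 * j + 1)) :
    ∃ ν : ZMod p, ¬ IsSquare (algebraMap (ZMod p) F ν) := by
  have hK : ringChar (ZMod p) ≠ 2 := ringChar_ne_two_of_card (by rwa [ZMod.card])
  obtain ⟨ν, hν⟩ := FiniteField.exists_nonsquare hK
  have hν0 : ν ≠ 0 := by rintro rfl; simp at hν
  refine ⟨ν, ?_⟩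
  rw [FiniteField.isSquare_iff
    (ringChar_ne_two_of_card (by rw [hF]; exact hp.pow)) (by simpa using hν0), ← map_pow, hF]
  have h1 := (FiniteField.pow_dichotomy hK hν0).resolve_left
    fun h => hν ((FiniteField.isSquare_iff hK hν0).2 h)
  rw [ZMod.card] at h1
  obtain ⟨a, ha⟩ := hp
  obtain ⟨d, hd⟩ := exists_pow_two_mul_eq a j
  have h : p ^ (2 * j + 1) / 2 = p / 2 + (p - 1) * ((a + 1) * d * p) := by
    rw [pow_succ, ha, hd, Nat.add_sub_cancel,
      show (1 + 4 * a * (a + 1) * d) * (2 * a + 1) =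
        1 + 2 * (a + 2 * a * ((a + 1) * d * (2 * a + 1))) by ring]
    omega
  rw [h, pow_add, h1, pow_mul, ZMod.pow_card_sub_one_eq_one hν0, one_pow, mul_one, map_neg, map_one]
  have hF2 : ringChar F ≠ 2 :=
    ringChar_ne_two_of_card (by rw [hF, ha]; exact (odd_two_mul_add_one a).pow)
  exact Ring.neg_one_ne_one_of_char_ne_two hF2

end PrimeField

/-! ### Distinctness and integrality of the listed weights. -/

/-- Used with `X = p ^ (2m)`, `B = p ^ (2m-1) (p-1)`, `s = p ^ ((3m-2)/2)` and `S = (p-1) s`. The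
gaps exceed `1`, so the extra `1` from infinity causes no collision. -/
theorem weights_even_nodup_and_nonneg {X B S s : ℤ} (hs : 1 < s) (hS : s + 1 < S) (hB : S + 1 < B)
    (hX : B + S + 1 < X) {e : ℤ} (he : e = 1 ∨ e = -1) {L : List ℤ}
    (hL : L = [0, X, B, B + 1, B + S * e, B + S * e + 1, B - s * e, B - s * e + 1, B - S * e,
      B - S * e + 1, B + s * e, B + s * e + 1]) : L.Nodup ∧ ∀ z ∈ L, 0 ≤ z := by
  subst hL
  rcases he with rfl | rfl <;>
  · simp only [List.nodup_cons, List.mem_cons, List.not_mem_nil, not_or, List.nodup_nil,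
      forall_eq_or_imp, or_false, not_false_eq_true, forall_eq, and_true]
    and_intros <;> omega

theorem weights_odd_nodup_and_nonneg {X B s : ℤ} (hs : 1 < s) (hB : s + 1 < B) (hX : B + s + 1 < X)
    {e : ℤ} (he : e = 1 ∨ e = -1) {L : List ℤ}
    (hL : L = [0, X, B, B + 1, B - s * e, B - s * e + 1, B + s * e, B + s * e + 1]) :
    L.Nodup ∧ ∀ z ∈ L, 0 ≤ z := by
  subst hL
  rcases he with rfl | rfl <;>
  · simp only [List.nodup_cons, List.mem_cons, List.not_mem_nil, not_or, List.nodup_nil,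
      forall_eq_or_imp, or_false, not_false_eq_true, forall_eq, and_true]
    and_intros <;> omega

theorem nodup_and_natural_of_eq_map {T : List (ℂ × ℂ)} {L : List ℤ}
    (h : T.map Prod.fst = L.map (fun z : ℤ => (z : ℂ))) (hL : L.Nodup ∧ ∀ z ∈ L, 0 ≤ z) :
    (T.map Prod.fst).Nodup ∧ ∀ r ∈ T, ∃ w : ℕ, (w : ℂ) = r.1 := by
  refine ⟨h ▸ hL.1.map Int.cast_injective, fun r hr => ?_⟩
  have : r.1 ∈ T.map Prod.fst := List.mem_map_of_mem hr
  rw [h] at this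
  obtain ⟨z, hz, hzr⟩ := List.mem_map.1 this
  lift z to ℕ using hL.2 z hz
  exact ⟨z, by rw [← hzr]; simp⟩

theorem I_pow_two_mul_eq (n : ℕ) : ∃ e : ℤ, (e = 1 ∨ e = -1) ∧ Complex.I ^ (2 * n) = e := by
  rw [pow_mul, Complex.I_sq]
  rcases neg_one_pow_eq_or ℂ n with h | h
  · exact ⟨1, Or.inl rfl, by simp [h]⟩
  · exact ⟨-1, Or.inr rfl, by simp [h]⟩

theorem tableEven_eq (p j : ℕ) {e : ℤ} (he : Complex.I ^ ((p - 1) / 2 * (2 * j + 2)) = e) :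
    (tableEven p (2 * j + 2)).map Prod.fst = [0, (p : ℤ) ^ (4 * j + 4),
      (p : ℤ) ^ (4 * j + 3) * (p - 1), p ^ (4 * j + 3) * (p - 1) + 1,
      p ^ (4 * j + 3) * (p - 1) + (p - 1) * p ^ (3 * j + 2) * e,
      p ^ (4 * j + 3) * (p - 1) + (p - 1) * p ^ (3 * j + 2) * e + 1,
      p ^ (4 * j + 3) * (p - 1) - p ^ (3 * j + 2) * e,
      p ^ (4 * j + 3) * (p - 1) - p ^ (3 * j + 2) * e + 1,
      p ^ (4 * j + 3) * (p - 1) - (p - 1) * p ^ (3 * j + 2) * e,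
      p ^ (4 * j + 3) * (p - 1) - (p - 1) * p ^ (3 * j + 2) * e + 1,
      p ^ (4 * j + 3) * (p - 1) + p ^ (3 * j + 2) * e,
      p ^ (4 * j + 3) * (p - 1) + p ^ (3 * j + 2) * e + 1].map (fun z : ℤ => (z : ℂ)) := by
  have h1 : 2 * (2 * j + 2) - 1 = 4 * j + 3 := by omega
  have h2 : (2 * j + 2) / 2 = j + 1 := by omega
  have h3 : 2 * j + 2 - 1 = 2 * j + 1 := by omega
  simp only [tableEven, he, h1, h2, h3, List.map_cons, List.map_nil, List.cons.injEq]
  push_cast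
  refine ⟨?_, ?_, ?_, ?_, ?_, ?_, ?_, ?_, ?_, ?_, ?_, ?_, ?_⟩ <;> first | trivial | ring

theorem tableOdd_eq (p j : ℕ) {e : ℤ} (he : Complex.I ^ ((p - 1) * (2 * j + 1 + 1) / 2) = e) :
    (tableOdd p (2 * j + 1)).map Prod.fst = [0, (p : ℤ) ^ (4 * j + 2),
      (p : ℤ) ^ (4 * j + 1) * (p - 1), p ^ (4 * j + 1) * (p - 1) + 1,
      p ^ (4 * j + 1) * (p - 1) - p ^ (3 * j + 1) * e,
      p ^ (4 * j + 1) * (p - 1) - p ^ (3 * j + 1) * e + 1,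
      p ^ (4 * j + 1) * (p - 1) + p ^ (3 * j + 1) * e,
      p ^ (4 * j + 1) * (p - 1) + p ^ (3 * j + 1) * e + 1].map (fun z : ℤ => (z : ℂ)) := by
  have h1 : 2 * (2 * j + 1) - 1 = 4 * j + 1 := by omega
  have h2 : (2 * j + 1 - 1) / 2 = j := by omega
  have h3 : (3 * (2 * j + 1) - 1) / 2 = 3 * j + 1 := by omega
  simp only [tableOdd, he, h1, h2, h3, List.map_cons, List.map_nil, List.cons.injEq]
  push_cast
  refine ⟨?_, ?_, ?_, ?_, ?_, ?_, ?_, ?_, ?_⟩ <;> first | trivial | ring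

theorem tableEven_nodup_and_natural {p : ℕ} (hp : 2 < p) (j : ℕ) {e : ℤ} (he : e = 1 ∨ e = -1)
    (hI : Complex.I ^ ((p - 1) / 2 * (2 * j + 2)) = e) :
    ((tableEven p (2 * j + 2)).map Prod.fst).Nodup ∧
      ∀ r ∈ tableEven p (2 * j + 2), ∃ w : ℕ, (w : ℂ) = r.1 := by
  have hp' : (3 : ℤ) ≤ p := by exact_mod_cast hp
  have hs : (9 : ℤ) ≤ (p : ℤ) ^ (3 * j + 2) := by
    calc (9 : ℤ) = 3 ^ 2 := by norm_num
      _ ≤ (p : ℤ) ^ 2 := by gcongr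
      _ ≤ _ := pow_le_pow_right₀ (by omega) (by omega)
  have hb : (p : ℤ) * (p : ℤ) ^ (3 * j + 2) ≤ (p : ℤ) ^ (4 * j + 3) := by
    rw [← pow_succ']
    exact pow_le_pow_right₀ (by omega) (by omega)
  have hX : (p : ℤ) ^ (4 * j + 4) = (p : ℤ) ^ (4 * j + 3) * p := pow_succ _ _
  have h1 := mul_le_mul_of_nonneg_right hp' (by omega : (0 : ℤ) ≤ (p : ℤ) ^ (3 * j + 2))
  have h2 := mul_le_mul_of_nonneg_left hp' (by omega : (0 : ℤ) ≤ (p : ℤ) ^ (4 * j + 3))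
  refine nodup_and_natural_of_eq_map (tableEven_eq p j hI)
    (weights_even_nodup_and_nonneg ?_ ?_ ?_ ?_ he rfl) <;> linarith

/-- For `j = 0`, that is `m = 1`, the weight `p (p - 1) + p` would coincide with `p ^ 2`. -/
theorem tableOdd_nodup_and_natural {p : ℕ} (hp : 2 < p) {j : ℕ} (hj : 0 < j) {e : ℤ}
    (he : e = 1 ∨ e = -1) (hI : Complex.I ^ ((p - 1) * (2 * j + 1 + 1) / 2) = e) :
    ((tableOdd p (2 * j + 1)).map Prod.fst).Nodup ∧
      ∀ r ∈ tableOdd p (2 * j + 1), ∃ w : ℕ, (w : ℂ) = r.1 := by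
  have hp' : (3 : ℤ) ≤ p := by exact_mod_cast hp
  have hs : (9 : ℤ) ≤ (p : ℤ) ^ (3 * j + 1) := by
    calc (9 : ℤ) = 3 ^ 2 := by norm_num
      _ ≤ (p : ℤ) ^ 2 := by gcongr
      _ ≤ _ := pow_le_pow_right₀ (by omega) (by omega)
  have hb : (p : ℤ) * (p : ℤ) ^ (3 * j + 1) ≤ (p : ℤ) ^ (4 * j + 1) := by
    rw [← pow_succ']
    exact pow_le_pow_right₀ (by omega) (by omega)
  have hX : (p : ℤ) ^ (4 * j + 2) = (p : ℤ) ^ (4 * j + 1) * p := pow_succ _ _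
  have h1 := mul_le_mul_of_nonneg_right hp' (by omega : (0 : ℤ) ≤ (p : ℤ) ^ (3 * j + 1))
  have h2 := mul_le_mul_of_nonneg_left hp' (by omega : (0 : ℤ) ≤ (p : ℤ) ^ (4 * j + 1))
  refine nodup_and_natural_of_eq_map (tableOdd_eq p j hI)
    (weights_odd_nodup_and_nonneg ?_ ?_ ?_ he rfl) <;> linarith

/-! ### Matching the sums with the tables. -/

section PrimeField

variable {p : ℕ} [Fact p.Prime] {F : Type*} [Field F] [Fintype F] [Algebra (ZMod p) F]

theorem sum_hammingNorm_eq_tableEven (hp : Odd p) (h2 : (2 : F) ≠ 0) {j : ℕ}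
    (hF : Fintype.card F = p ^ (2 * j + 2)) (g : ℂ → ℂ) :
    ∑ t : F × F × F × ZMod p, g (hammingNorm (quadricTraceWord (ZMod p) F t) : ℕ) =
      ((tableEven p (2 * j + 2)).map fun r => r.2 * g r.1).sum := by
  classical
  have hr : Fintype.card F = Fintype.card (ZMod p) * p ^ (2 * j + 1) := by
    rw [hF, ZMod.card]; ring
  have hchar : ringChar F ≠ 2 := ringChar_ne_two_of_card (by rw [hF]; exact hp.pow)
  rw [sum_hammingNorm_quadricTraceWord hr h2 g, sum_quadratic_words_even hr h2 hchar
    (isSquare_algebraMap_of_card_eq (j := j + 1) hp (by rw [hF]; ring)) (s := (p : ℂ) ^ j)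
    (by rw [ZMod.card]; push_cast; ring)]
  have h1 : 2 * (2 * j + 2) - 1 = 4 * j + 3 := by omega
  have h2 : (2 * j + 2) / 2 = j + 1 := by omega
  have h3 : 2 * j + 2 - 1 = 2 * j + 1 := by omega
  have h4 : (3 * (2 * j + 2) - 2) / 2 = 3 * j + 2 := by omega
  obtain ⟨e, he, hI⟩ := I_pow_two_mul_eq ((p - 1) / 2 * (j + 1))
  rw [show 2 * ((p - 1) / 2 * (j + 1)) = (p - 1) / 2 * (2 * j + 2) by ring] at hI
  simp only [tableEven, hI, h1, h2, h3, h4, List.map_cons, List.map_nil, List.sum_cons,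
    List.sum_nil, hF, ZMod.card]
  -- Both signs give the same sum with rows permuted; `ring_nf` also normalizes the arguments of
  -- `g`.
  rcases he with rfl | rfl <;> push_cast <;> ring_nf

theorem sum_hammingNorm_eq_tableOdd (hp : Odd p) (h2 : (2 : F) ≠ 0) {j : ℕ}
    (hF : Fintype.card F = p ^ (2 * j + 1)) (g : ℂ → ℂ) :
    ∑ t : F × F × F × ZMod p, g (hammingNorm (quadricTraceWord (ZMod p) F t) : ℕ) =
      ((tableOdd p (2 * j + 1)).map fun r => r.2 * g r.1).sum := by
  classical
  have hr : Fintype.card F = Fintype.card (ZMod p) * p ^ (2 * j) := by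
    rw [hF, ZMod.card]; ring
  have hchar : ringChar F ≠ 2 := ringChar_ne_two_of_card (by rw [hF]; exact hp.pow)
  have hcharK : ringChar (ZMod p) ≠ 2 := ringChar_ne_two_of_card (by rwa [ZMod.card])
  obtain ⟨ν, hν⟩ := exists_not_isSquare_algebraMap_of_card_eq hp hF
  rw [sum_hammingNorm_quadricTraceWord hr h2 g,
    sum_quadratic_words_odd hr h2 hchar hcharK hν (s := (p : ℂ) ^ j) (by push_cast; ring)]
  have h1 : 2 * (2 * j + 1) - 1 = 4 * j + 1 := by omega
  have h2 : 2 * j / 2 = j := by omega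
  have h3 : 2 * j + 1 - 1 = 2 * j := by omega
  have h4 : (3 * (2 * j + 1) - 1) / 2 = 3 * j + 1 := by omega
  obtain ⟨a, ha⟩ := id hp
  obtain ⟨e, he, hI⟩ := I_pow_two_mul_eq (a * (j + 1))
  rw [show 2 * (a * (j + 1)) = (p - 1) * (2 * j + 1 + 1) / 2 by
    rw [ha, Nat.add_sub_cancel, show 2 * a * (2 * j + 1 + 1) = 2 * (2 * (a * (j + 1))) by ring]
    omega] at hI
  simp only [tableOdd, hI, h1, h2, h3, h4, List.map_cons, List.map_nil, List.sum_cons,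
    List.sum_nil, hF, ZMod.card]
  rcases he with rfl | rfl <;> push_cast <;> ring_nf

end PrimeField

/-! ### Length, dimension and weight distribution. -/

theorem mainTheorem4 (p : ℕ) [Fact p.Prime] (hp : 2 < p) (m : ℕ) (hm : 1 < m)
    {F : Type*} [Field F] [Fintype F] [Algebra (ZMod p) F] (hF : Fintype.card F = p ^ m)
    {κ β : Type*} (b : Module.Basis β (ZMod p) F) (G : Matrix κ (Option (F × F)) F)
    (hG : IsGeneratorMatrix G (quadricCode (4⁻¹ : F))) :
    Fintype.card (Option (F × F)) = p ^ (2 * m) + 1 ∧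
    Module.finrank (ZMod p) (subfieldCode b G) = 3 * m + 1 ∧
    (Even m → HasWeightDistribution (subfieldCode b G) (tableEven p m)) ∧
    (Odd m → HasWeightDistribution (subfieldCode b G) (tableOdd p m)) := by
  have hodd : Odd p := (Fact.out : p.Prime).odd_of_ne_two hp.ne'
  have h2 : (2 : F) ≠ 0 :=
    Ring.two_ne_zero (ringChar_ne_two_of_card (by rw [hF]; exact hodd.pow))
  have hinj := quadricTraceWord_injective (K := ZMod p) h2
  have hmem := mem_subfieldCode_quadricCode_iff h2 b G hG.2
  refine ⟨?_, ?_, ?_, ?_⟩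
  · rw [Fintype.card_option, Fintype.card_prod, hF]
    ring
  · have hrange : subfieldCode b G = LinearMap.range (quadricTraceWord (ZMod p) F) := by
      ext c
      rw [hmem, LinearMap.mem_range]
    have hdim : Module.finrank (ZMod p) F = m := by
      have h := Module.card_eq_pow_finrank (K := ZMod p) (V := F)
      rw [hF, ZMod.card] at h
      exact (Nat.pow_right_injective (by omega : 2 ≤ p) h).symm
    rw [hrange, LinearMap.finrank_range_of_inj hinj]
    simp only [Module.finrank_prod, hdim, Module.finrank_self]
    ring
  · intro hmeven
    obtain ⟨j, rfl⟩ : ∃ j, m = 2 * j + 2 := by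
      obtain ⟨k, hk⟩ := hmeven
      exact ⟨k - 1, by omega⟩
    obtain ⟨e, he, hI⟩ := I_pow_two_mul_eq ((p - 1) / 2 * (j + 1))
    rw [show 2 * ((p - 1) / 2 * (j + 1)) = (p - 1) / 2 * (2 * j + 2) by ring] at hI
    obtain ⟨hnodup, hnat⟩ := tableEven_nodup_and_natural hp j he hI
    exact hasWeightDistribution_of_sum _ _ _ hinj hmem hnodup hnat
      (sum_hammingNorm_eq_tableEven hodd h2 hF)
  · rintro ⟨j, rfl⟩
    obtain ⟨a, ha⟩ := id hodd
    obtain ⟨e, he, hI⟩ := I_pow_two_mul_eq (a * (j + 1))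
    rw [show 2 * (a * (j + 1)) = (p - 1) * (2 * j + 1 + 1) / 2 by
      rw [ha, Nat.add_sub_cancel, show 2 * a * (2 * j + 1 + 1) = 2 * (2 * (a * (j + 1))) by ring]
      omega] at hI
    obtain ⟨hnodup, hnat⟩ := tableOdd_nodup_and_natural hp (by omega) he hI
    exact hasWeightDistribution_of_sum _ _ _ hinj hmem hnodup hnat
      (sum_hammingNorm_eq_tableOdd hodd h2 hF)
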